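/- **Formulae and structures.** Fix countably many atomic propositions $p_0,p_1,\dots$. Formulae, in negation normal form, are built from the units $\mathsf f$, $\mathsf t$ and the atoms $p_i,\bar p_i$ by disjunction $(A\lor B)$ and conjunction $(A\land B)$; $\bar A$ is the De Morgan dual of $A$ (with $\bar{\mathsf f}=\mathsf t$, $\bar{\mathsf t}=\mathsf f$). *Structures* are formulae modulo the smallest congruence containing associativity and commutativity of $\lor$ and of $\land$. Write $S\{\;\}$ for a formula with one hole (not under a negation), and $\mathrm{at}\,R$ for the set of units and atoms occurring in $R$. **The system $\mathsf{KSdli}$.** Its rules, for every context $S\{\;\}$, are as follows, written premise $\to$ conclusion: $$\begin{array}{ll} \mathsf{ai}{\downarrow}: S\{\mathsf t\}\to S(a\lor\bar a)\ \ (a\text{ an atom } p_i\text{ or }\bar p_i), & \mathsf w{\downarrow}: S\{\mathsf f\}\to S\{R\},\\ \mathsf c{\downarrow}: S(R\lor R)\to S\{R\}, & \mathsf u_1{\downarrow}: S\{R\}\to S(R\lor\mathsf f),\\ \mathsf u_2{\downarrow}: S\{R\}\to S(R\land\mathsf t), & \mathsf u_3{\downarrow}: S\{\mathsf t\}\to S(\mathsf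 t\lor\mathsf t),\\ \mathsf u_4{\downarrow}: S\{\mathsf f\}\to S(\mathsf f\land\mathsf f), & \mathsf{dlis}: S((U\lor R)\land T)\to S(U\lor(R\land T)), \end{array}$$ where $\mathsf{dlis}$ (deep lazy interaction switch) requires that $\mathrm{at}\,\bar R\cap\mathrm{at}\,U\neq\emptyset$, that $U$ is a conjunction, an atom or $\mathsf t$, and that $R$ is a disjunction, an atom or $\mathsf f$. A proof in $\mathsf{KSdli}$ is a finite chain of structures, starting with the premise $\mathsf t$, in which each structure is obtained from the previous one by an instance of a rule, applied modulo the congruence; its last structure is its conclusion. **Analytic Gentzen.** Sequents $\vdash\varphi$ are finite multisets $\varphi$ of formulae (no congruence is used), read as the disjunction of their members. Proofs are finite trees built with the rules $$\frac{}{\vdash A,\bar A}\quad\frac{}{\vdash \mathsf t}\quad\frac{\vdash\varphi}{\vdash\varphi,A}\quad\frac{\vdash\varphi,A,A}{\vdash\varphi,A}\quad\frac{\vdash\varphi,A,B}{\vdash\varphi,A\lor B}\quad\frac{\vdash\varphi,A\quad\vdash B,\psi}{\vdash\varphi,A\land B,\psi}.$$ In both systems the size $|\Pi|$ of a proof $\Pi$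 is the total number of occurrences of units and atoms in it (over all structures of the chain, respectively all sequents of the tree). **Corollary.** $\mathsf{KSdli}$ polynomially simulates Analytic Gentzen: there is a polynomial $p$ such that for every Analytic Gentzen proof $\Phi$ there is a $\mathsf{KSdli}$ proof $\Pi$, whose conclusion is the structure denoted by the conclusion of $\Phi$, with $|\Pi|\le p(|\Phi|)$. -/

import Mathlib

namespace DeepInf

/-- Classical formulae in negation normal form over countably many atomic propositions:
the units `ff` and `tt`, the atoms `a` and `ā`, disjunctions and conjunctions. -/
inductive Formula : Type
  | ff : Formula
  | tt : Formula
  | atom : ℕ → Formula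
  | natom : ℕ → Formula
  | or : Formula → Formula → Formula
  | and : Formula → Formula → Formula

namespace Formula

/-- Negation, pushed to the atoms by the De Morgan equations. -/
def neg : Formula → Formula
  | ff => tt
  | tt => ff
  | atom n => natom n
  | natom n => atom n
  | or A B => and (neg A) (neg B)
  | and A B => or (neg A) (neg B)

/-- The number of unit and atom occurrences. -/
def size : Formula → ℕ
  | ff => 1
  | tt => 1
  | atom _ => 1
  | natom _ => 1
  | or A B => size A + size B
  | and A B => size A + size B

/-- The set `at R` of the atoms of `R`; the units count as (special) atoms. -/
def atoms : Formula → Set Formula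
  | ff => {ff}
  | tt => {tt}
  | atom n => {atom n}
  | natom n => {natom n}
  | or A B => atoms A ∪ atoms B
  | and A B => atoms A ∪ atoms B

/-- The smallest congruence containing associativity and commutativity of `or` and `and`. -/
inductive Congr : Formula → Formula → Prop
  | refl (A : Formula) : Congr A A
  | symm {A B : Formula} : Congr A B → Congr B A
  | trans {A B C : Formula} : Congr A B → Congr B C → Congr A C
  | or_assoc (A B C : Formula) : Congr (or (or A B) C) (or A (or B C))
  | or_comm (A B : Formula) : Congr (or A B) (or B A)
  | and_assoc (A B C : Formula) : Congr (and (and A B) C) (and A (and B C))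
  | and_comm (A B : Formula) : Congr (and A B) (and B A)
  | or_congr {A A' B B' : Formula} : Congr A A' → Congr B B' → Congr (or A B) (or A' B')
  | and_congr {A A' B B' : Formula} : Congr A A' → Congr B B' → Congr (and A B) (and A' B')

instance congrSetoid : Setoid Formula :=
  ⟨Congr, ⟨Congr.refl, Congr.symm, Congr.trans⟩⟩

theorem Congr.size_eq {A B : Formula} (h : Congr A B) : size A = size B := by
  induction h <;> (try simp only [size]) <;> omega

/-- The disjunction of a list of formulae (of the list `[A]` it is `A` itself). -/
def listOr : List Formula → Formula
  | [] => ff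
  | [A] => A
  | A :: B :: L => or A (listOr (B :: L))

theorem listOr_perm {L L' : List Formula} (h : L.Perm L') : Congr (listOr L) (listOr L') := by
  induction h with
  | nil => exact Congr.refl _
  | @cons A L₁ L₂ h ih =>
    cases L₁ with
    | nil => rw [h.nil_eq]; exact Congr.refl _
    | cons B L₁ =>
      cases L₂ with
      | nil => exact absurd h.eq_nil (by simp)
      | cons C L₂ => exact Congr.or_congr (Congr.refl A) ih
  | swap A B L =>
    cases L with
    | nil => exact Congr.or_comm _ _
    | cons C L =>
      exact ((Congr.or_assoc _ _ _).symm.trans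
        (Congr.or_congr (Congr.or_comm _ _) (Congr.refl _))).trans (Congr.or_assoc _ _ _)
  | trans _ _ ih₁ ih₂ => exact ih₁.trans ih₂

end Formula

/-- Structures are formulae modulo associativity and commutativity. -/
def Structure : Type := Quotient Formula.congrSetoid

/-- The structure denoted by a formula. -/
def Structure.mk (A : Formula) : Structure := Quotient.mk Formula.congrSetoid A

/-- The number of unit and atom occurrences in a structure. -/
def Structure.size : Structure → ℕ :=
  Quotient.lift Formula.size (fun _ _ h => Formula.Congr.size_eq h)

/-- Structure contexts `S{ }`. -/
inductive Context : Type
  | hole : Context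
  | orLeft : Context → Formula → Context
  | orRight : Formula → Context → Context
  | andLeft : Context → Formula → Context
  | andRight : Formula → Context → Context

/-- `S.fill R` is `S{R}`. -/
def Context.fill : Context → Formula → Formula
  | hole, R => R
  | orLeft S B, R => Formula.or (S.fill R) B
  | orRight A S, R => Formula.or A (S.fill R)
  | andLeft S B, R => Formula.and (S.fill R) B
  | andRight A S, R => Formula.and A (S.fill R)

/-- An inference rule, given by its instances: `ρ Q P` says that `Q` is the premise and `P` the
conclusion of an instance of `ρ`. -/
def Rule : Type := Structure → Structure → Prop

/-- The deep inference rule with premise `S{T}` and conclusion `S{R}`, for every context `S{ }` and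
all contracta `T` and redexes `R` with `r T R`. -/
def deepRule (r : Formula → Formula → Prop) : Rule :=
  fun Q P => ∃ (S : Context) (T R : Formula),
    r T R ∧ Q = Structure.mk (S.fill T) ∧ P = Structure.mk (S.fill R)

/-- Atomic interaction. -/
def aiDown : Rule := deepRule fun T R =>
  ∃ n : ℕ, T = Formula.tt ∧ R = Formula.or (Formula.atom n) (Formula.natom n)

/-- Weakening. -/
def wDown : Rule := deepRule fun T _ => T = Formula.ff

/-- Contraction. -/
def cDown : Rule := deepRule fun T R => T = Formula.or R R

/-- Unit one. -/
def u1Down : Rule := deepRule fun T R => R = Formula.or T Formula.ff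

/-- Unit two. -/
def u2Down : Rule := deepRule fun T R => R = Formula.and T Formula.tt

/-- Unit three. -/
def u3Down : Rule := deepRule fun T R => T = Formula.tt ∧ R = Formula.or Formula.tt Formula.tt

/-- Unit four. -/
def u4Down : Rule := deepRule fun T R => T = Formula.ff ∧ R = Formula.and Formula.ff Formula.ff

/-- `R` and `U` can interact: they contain complementary atoms. -/
def CanInteract (R U : Formula) : Prop := (R.neg.atoms ∩ U.atoms).Nonempty

/-- The side condition of lazy switch: `U` is a conjunction or an atom different from `ff`. -/
def IsLazy : Formula → Prop
  | Formula.ff => False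
  | Formula.tt => True
  | Formula.atom _ => True
  | Formula.natom _ => True
  | Formula.or _ _ => False
  | Formula.and _ _ => True

/-- The side condition of deep switch: `R` is a disjunction or an atom different from `tt`. -/
def IsDeep : Formula → Prop
  | Formula.ff => True
  | Formula.tt => False
  | Formula.atom _ => True
  | Formula.natom _ => True
  | Formula.or _ _ => True
  | Formula.and _ _ => False

/-- Deep lazy interaction switch: the instances of the switch rule, with conclusion
`S(U ∨ (R ∧ T))` and premise `S((U ∨ R) ∧ T)`, that satisfy the three side conditions. -/
def dlis : Rule := deepRule fun Q P => ∃ U R T : Formula,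
  CanInteract R U ∧ IsLazy U ∧ IsDeep R ∧
    Q = Formula.and (Formula.or U R) T ∧ P = Formula.or U (Formula.and R T)

/-- The system `KSdli`. -/
def KSdli : Set Rule :=
  {aiDown, dlis, wDown, cDown, u1Down, u2Down, u3Down, u4Down}

/-- `Derivation 𝒮 T R`: the derivations in the system `𝒮` with premise `T` and conclusion `R`,
that is, the finite chains of instances of rules of `𝒮` leading from `T` to `R`. -/
inductive Derivation (𝒮 : Set Rule) (T : Structure) : Structure → Type
  | nil : Derivation 𝒮 T T
  | step {Q P : Structure} (Δ : Derivation 𝒮 T Q) (ρ : Rule) (hρ : ρ ∈ 𝒮) (h : ρ Q P) :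
      Derivation 𝒮 T P

/-- The number of unit and atom occurrences in (all the structures of) a derivation. -/
def Derivation.size {𝒮 : Set Rule} {T : Structure} :
    {R : Structure} → Derivation 𝒮 T R → ℕ
  | _, nil => T.size
  | _, @step _ _ _ P Δ _ _ _ => Δ.size + P.size

/-- The size of a sequent: the number of unit and atom occurrences. -/
def sequentSize (φ : Multiset Formula) : ℕ := (φ.map Formula.size).sum

/-- The structure denoted by a sequent: the disjunction of its formulae. -/
def sequentStructure : Multiset Formula → Structure :=
  Quotient.lift (fun L : List Formula => Structure.mk (Formula.listOr L))
    (fun _ _ h => Quotient.sound (s := Formula.congrSetoid) (Formula.listOr_perm h))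

/-- `GentzenProof φ`: the proofs of the sequent `⊢ φ` in the system Analytic Gentzen, that is, the
trees of instances of the inference rules without open premises. -/
inductive GentzenProof : Multiset Formula → Type
  | id (A : Formula) : GentzenProof {A, A.neg}
  | tt : GentzenProof {Formula.tt}
  | weak {φ : Multiset Formula} (A : Formula) : GentzenProof φ → GentzenProof (A ::ₘ φ)
  | contr {φ : Multiset Formula} (A : Formula) :
      GentzenProof (A ::ₘ A ::ₘ φ) → GentzenProof (A ::ₘ φ)
  | or {φ : Multiset Formula} (A B : Formula) :
      GentzenProof (A ::ₘ B ::ₘ φ) → GentzenProof (Formula.or A B ::ₘ φ)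
  | and {φ ψ : Multiset Formula} (A B : Formula) :
      GentzenProof (A ::ₘ φ) → GentzenProof (B ::ₘ ψ) →
        GentzenProof (Formula.and A B ::ₘ (φ + ψ))

/-- The number of unit and atom occurrences in (all the sequents of) a proof. -/
def GentzenProof.size : {φ : Multiset Formula} → GentzenProof φ → ℕ
  | _, id A => sequentSize {A, A.neg}
  | _, tt => sequentSize {Formula.tt}
  | _, @weak φ A Φ => Φ.size + sequentSize (A ::ₘ φ)
  | _, @contr φ A Φ => Φ.size + sequentSize (A ::ₘ φ)
  | _, @or φ A B Φ => Φ.size + sequentSize (Formula.or A B ::ₘ φ)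
  | _, @and φ ψ A B Φ Ψ => Φ.size + Ψ.size + sequentSize (Formula.and A B ::ₘ (φ + ψ))

/-- What is needed in order to compare the sizes of proofs: proofs, the structures which they
prove, and their sizes. -/
structure ProofSystem where
  Proof : Type
  conclusion : Proof → Structure
  size : Proof → ℕ

/-- The proofs of a deep inference system: the derivations whose premise is the unit `tt`. -/
def deepProofSystem (𝒮 : Set Rule) : ProofSystem where
  Proof := Σ R : Structure, Derivation 𝒮 (Structure.mk Formula.tt) R
  conclusion Δ := Δ.1
  size Δ := Δ.2.size

/-- Analytic Gentzen; the multiset of formulae which a proof ends in stands for the disjunction. -/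
def analyticGentzen : ProofSystem where
  Proof := Σ φ : Multiset Formula, GentzenProof φ
  conclusion Φ := sequentStructure Φ.1
  size Φ := Φ.2.size

/-- `𝒮` polynomially simulates `𝒮'`: for some polynomial `p`, every proof in `𝒮'` of size `n` has
a counterpart in `𝒮` with the same conclusion and of size at most `p n`. -/
def PolynomiallySimulates (𝒮 𝒮' : ProofSystem) : Prop :=
  ∃ p : Polynomial ℕ, ∀ Φ : 𝒮'.Proof, ∃ Ψ : 𝒮.Proof,
    𝒮.conclusion Ψ = 𝒮'.conclusion Φ ∧ 𝒮.size Ψ ≤ p.eval (𝒮'.size Φ)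

end DeepInf

namespace DeepInf

open Formula

/-! ### Formulae: atoms, disjuncts and iterated disjunctions. -/

namespace Formula

/-! The obstacle is the Gentzen conjunction rule: moving its side formulae out of a conjunction
takes switches, and `dlis` allows a switch only between interacting formulae. The remedy is to prove
less than the sequent. Each Gentzen proof yields a derivation of the disjunction of some disjuncts
of the sequent, and this selection is kept connected for the relation "contain complementary atoms"
(`Good`); all that is missing is added at the end by weakening.

At a conjunction rule, either a premise's selection already lies in its side formulae, and the other
premise is discarded, or some selected disjunct comes only from the active formula. In the second
case connectedness orders the remaining disjuncts so that each interacts with what follows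
(`Connected.exists_chain`), so they can be switched out one at a time (`Chain.der_switch`). The new
conjunction contains all atoms of the disjuncts merged into it, so the new selection is again
connected (`Connected.replace`).

The other unary rules leave the derivation unchanged, since a selection is a set of disjuncts. Each
conjunction adds only linearly many steps and linear width, so length and width are both quadratic
and the size is quartic. -/

theorem neg_neg (A : Formula) : A.neg.neg = A := by
  induction A <;> simp_all [neg]

theorem size_neg (A : Formula) : A.neg.size = A.size := by
  induction A <;> simp_all [neg, size]

theorem size_pos (A : Formula) : 0 < A.size := by
  induction A <;> simp_all [size]

theorem neg_mem_atoms_neg {x A : Formula} (h : x ∈ A.atoms) : x.neg ∈ A.neg.atoms := by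
  induction A with
  | or A B ihA ihB => exact h.imp ihA ihB
  | and A B ihA ihB => exact h.imp ihA ihB
  | _ => obtain rfl := h; rfl

theorem neg_mem_atoms {x A : Formula} (h : x ∈ A.neg.atoms) : x.neg ∈ A.atoms := by
  simpa only [neg_neg] using neg_mem_atoms_neg h

theorem atoms_neg_mono {A B : Formula} (h : A.atoms ⊆ B.atoms) : A.neg.atoms ⊆ B.neg.atoms := by
  intro x hx
  simpa only [neg_neg] using neg_mem_atoms_neg (h (neg_mem_atoms hx))

/-- The maximal subformulae of a disjunction that are neither disjunctions nor `ff`. -/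
def flat : Formula → List Formula
  | ff => []
  | or A B => flat A ++ flat B
  | tt => [tt]
  | atom n => [atom n]
  | natom n => [natom n]
  | and A B => [and A B]

theorem isLazy_of_mem_flat {x A : Formula} (h : x ∈ A.flat) : IsLazy x := by
  induction A with
  | ff => simp [flat] at h
  | or A B ihA ihB => exact (List.mem_append.1 h).elim ihA ihB
  | _ => obtain rfl := List.mem_singleton.1 h; trivial

theorem atoms_subset_of_mem_flat {x A : Formula} (h : x ∈ A.flat) : x.atoms ⊆ A.atoms := by
  induction A with
  | ff => simp [flat] at h
  | or A B ihA ihB =>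
    exact (List.mem_append.1 h).elim (fun h => (ihA h).trans Set.subset_union_left)
      (fun h => (ihB h).trans Set.subset_union_right)
  | _ => obtain rfl := List.mem_singleton.1 h; exact subset_rfl

theorem sum_size_flat_le (A : Formula) : (A.flat.map size).sum ≤ A.size := by
  induction A with
  | or A B ihA ihB => simp only [flat, List.map_append, List.sum_append, size]; omega
  | _ => simp [flat, size]

/-- The disjunction of the formulae of a list and of a further formula. -/
def ors (Γ : List Formula) (R : Formula) : Formula := Γ.foldr Formula.or R

@[simp] theorem ors_nil (R : Formula) : ors [] R = R := rfl

@[simp] theorem ors_cons (L : Formula) (Γ : List Formula) (R : Formula) :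
    ors (L :: Γ) R = or L (ors Γ R) := rfl

theorem ors_append (Γ Δ : List Formula) (R : Formula) : ors (Γ ++ Δ) R = ors Γ (ors Δ R) :=
  List.foldr_append

theorem size_ors (Γ : List Formula) (R : Formula) :
    (ors Γ R).size = (Γ.map size).sum + R.size := by
  induction Γ with
  | nil => simp
  | cons L Γ ih => simp [size, ih, add_assoc]

theorem length_le_sum_size (Γ : List Formula) : Γ.length ≤ (Γ.map size).sum := by
  induction Γ with
  | nil => simp
  | cons L Γ ih =>
    have := L.size_pos
    simp only [List.length_cons, List.map_cons, List.sum_cons]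
    omega

theorem atoms_subset_ors (Γ : List Formula) (R : Formula) : R.atoms ⊆ (ors Γ R).atoms := by
  induction Γ with
  | nil => exact subset_rfl
  | cons L Γ ih => exact ih.trans Set.subset_union_right

theorem atoms_subset_ors_of_mem {x : Formula} {Γ : List Formula} (h : x ∈ Γ) (R : Formula) :
    x.atoms ⊆ (ors Γ R).atoms := by
  induction Γ with
  | nil => simp at h
  | cons L Γ ih =>
    rcases List.mem_cons.1 h with rfl | h
    · exact Set.subset_union_left
    · exact (ih h).trans Set.subset_union_right

theorem Congr.or_left_comm (A B C : Formula) : Congr (or A (or B C)) (or B (or A C)) :=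
  ((Congr.or_assoc _ _ _).symm.trans
    (Congr.or_congr (Congr.or_comm _ _) (Congr.refl _))).trans (Congr.or_assoc _ _ _)

theorem ors_perm {Γ Δ : List Formula} (h : Γ.Perm Δ) (R : Formula) : Congr (ors Γ R) (ors Δ R) := by
  induction h with
  | nil => exact Congr.refl _
  | cons A _ ih => exact Congr.or_congr (Congr.refl A) ih
  | swap A B Γ => exact Congr.or_left_comm _ _ _
  | trans _ _ ih₁ ih₂ => exact ih₁.trans ih₂

/-- `x` is, up to congruence, a disjunct of `C`. -/
def Disjunct (x C : Formula) : Prop := Congr C x ∨ ∃ D, Congr C (or x D)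

theorem Disjunct.or_left {x A : Formula} (h : Disjunct x A) (B : Formula) :
    Disjunct x (or A B) := by
  rcases h with h | ⟨D, h⟩
  · exact Or.inr ⟨B, Congr.or_congr h (Congr.refl B)⟩
  · exact Or.inr ⟨or D B, (Congr.or_congr h (Congr.refl B)).trans (Congr.or_assoc _ _ _)⟩

theorem Disjunct.congr {x A B : Formula} (h : Disjunct x A) (hAB : Congr B A) : Disjunct x B :=
  h.imp hAB.trans (fun ⟨D, h⟩ => ⟨D, hAB.trans h⟩)

theorem Disjunct.or_right {x B : Formula} (h : Disjunct x B) (A : Formula) :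
    Disjunct x (or A B) :=
  (h.or_left A).congr (Congr.or_comm _ _)

theorem disjunct_of_mem_flat {x A : Formula} (h : x ∈ A.flat) : Disjunct x A := by
  induction A with
  | ff => simp [flat] at h
  | or A B ihA ihB =>
    exact (List.mem_append.1 h).elim (fun h => (ihA h).or_left B) (fun h => (ihB h).or_right A)
  | _ => obtain rfl := List.mem_singleton.1 h; exact Or.inl (Congr.refl _)

theorem disjunct_ors {x : Formula} {Γ : List Formula} (h : x ∈ Γ) (R : Formula) :
    Disjunct x (ors Γ R) := by
  induction Γ with
  | nil => simp at h
  | cons L Γ ih =>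
    rcases List.mem_cons.1 h with rfl | h
    · exact Or.inr ⟨_, Congr.refl _⟩
    · exact (ih h).or_right L

theorem mem_flat_listOr {x A : Formula} {L : List Formula} (hA : A ∈ L) (hx : x ∈ A.flat) :
    x ∈ (listOr L).flat := by
  induction L with
  | nil => simp at hA
  | cons B L ih =>
    cases L with
    | nil => obtain rfl := List.mem_singleton.1 hA; exact hx
    | cons C L =>
      rcases List.mem_cons.1 hA with rfl | hA
      · exact List.mem_append_left _ hx
      · exact List.mem_append_right _ (ih hA)

theorem size_listOr_le (L : List Formula) : (listOr L).size ≤ (L.map size).sum + 1 := by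
  induction L with
  | nil => simp [listOr, size]
  | cons B L ih =>
    cases L with
    | nil => simp [listOr]
    | cons C L => simp only [listOr, size, List.map_cons, List.sum_cons] at ih ⊢; omega

end Formula

/-! ### Interaction and single inference steps. -/

theorem CanInteract.symm {A B : Formula} (h : CanInteract A B) : CanInteract B A := by
  obtain ⟨x, hA, hB⟩ := h
  exact ⟨x.neg, neg_mem_atoms_neg hB, neg_mem_atoms hA⟩

/-- Interaction sees only sets of atoms, at any depth, so burying a formula inside a larger one
never destroys it. -/
theorem CanInteract.mono {A A' B B' : Formula} (h : CanInteract A B) (hA : A.atoms ⊆ A'.atoms)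
    (hB : B.atoms ⊆ B'.atoms) : CanInteract A' B' :=
  Set.Nonempty.mono (Set.inter_subset_inter (atoms_neg_mono hA) hB) h

/-- One inference step of `KSdli` between the structures denoted by two formulae. -/
def Step (A B : Formula) : Prop := ∃ ρ ∈ KSdli, ρ (Structure.mk A) (Structure.mk B)

theorem Structure.mk_eq {A B : Formula} (h : Congr A B) : Structure.mk A = Structure.mk B :=
  Quotient.sound (s := Formula.congrSetoid) h

theorem Structure.congr_of_mk_eq {A B : Formula} (h : Structure.mk A = Structure.mk B) :
    Congr A B :=
  Quotient.exact (s := Formula.congrSetoid) h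

theorem Step.congr {A A' B B' : Formula} (h : Step A B) (hA : Congr A' A) (hB : Congr B B') :
    Step A' B' := by
  obtain ⟨ρ, hρ, h⟩ := h
  exact ⟨ρ, hρ, by rwa [Structure.mk_eq hA, ← Structure.mk_eq hB]⟩

theorem exists_deepRule_of_mem {ρ : Rule} (h : ρ ∈ KSdli) : ∃ r, ρ = deepRule r := by
  rcases h with rfl | rfl | rfl | rfl | rfl | rfl | rfl | rfl <;> exact ⟨_, rfl⟩

theorem Step.or_right {A B : Formula} (h : Step A B) (X : Formula) : Step (or X A) (or X B) := by
  obtain ⟨ρ, hρ, h⟩ := h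
  obtain ⟨r, rfl⟩ := exists_deepRule_of_mem hρ
  obtain ⟨S, T, R, hr, hA, hB⟩ := h
  exact ⟨_, hρ, Context.orRight X S, T, R, hr,
    Structure.mk_eq (Congr.or_congr (Congr.refl X) (Structure.congr_of_mk_eq hA)),
    Structure.mk_eq (Congr.or_congr (Congr.refl X) (Structure.congr_of_mk_eq hB))⟩

theorem Step.and_right {A B : Formula} (h : Step A B) (X : Formula) :
    Step (and X A) (and X B) := by
  obtain ⟨ρ, hρ, h⟩ := h
  obtain ⟨r, rfl⟩ := exists_deepRule_of_mem hρ
  obtain ⟨S, T, R, hr, hA, hB⟩ := h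
  exact ⟨_, hρ, Context.andRight X S, T, R, hr,
    Structure.mk_eq (Congr.and_congr (Congr.refl X) (Structure.congr_of_mk_eq hA)),
    Structure.mk_eq (Congr.and_congr (Congr.refl X) (Structure.congr_of_mk_eq hB))⟩

theorem step_of_rule {r : Formula → Formula → Prop} (hr : deepRule r ∈ KSdli) {T R : Formula}
    (h : r T R) : Step T R :=
  ⟨_, hr, Context.hole, T, R, h, rfl, rfl⟩

theorem Step.interaction (n : ℕ) : Step tt (or (atom n) (natom n)) :=
  step_of_rule (show aiDown ∈ KSdli by simp [KSdli]) ⟨n, rfl, rfl⟩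

theorem Step.weakening (R : Formula) : Step ff R :=
  step_of_rule (show wDown ∈ KSdli by simp [KSdli]) rfl

theorem Step.contraction (R : Formula) : Step (or R R) R :=
  step_of_rule (show cDown ∈ KSdli by simp [KSdli]) rfl

theorem Step.or_ff (R : Formula) : Step R (or R ff) :=
  step_of_rule (show u1Down ∈ KSdli by simp [KSdli]) rfl

theorem Step.and_tt (R : Formula) : Step R (and R tt) :=
  step_of_rule (show u2Down ∈ KSdli by simp [KSdli]) rfl

theorem Step.switch {U R T : Formula} (h : CanInteract R U) (hU : IsLazy U) (hR : IsDeep R) :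
    Step (and (or U R) T) (or U (and R T)) :=
  step_of_rule (show dlis ∈ KSdli by simp [KSdli]) ⟨U, R, T, h, hU, hR, rfl, rfl⟩

theorem Step.absorb {x C : Formula} (h : Disjunct x C) : Step (or x C) C := by
  rcases h with h | ⟨D, h⟩
  · exact (Step.contraction x).congr (Congr.or_congr (Congr.refl x) h) h.symm
  · refine ((Step.contraction x).or_right D).congr ?_ ((Congr.or_comm _ _).trans h.symm)
    exact ((Congr.or_congr (Congr.refl x) h).trans (Congr.or_assoc _ _ _).symm).trans
      (Congr.or_comm _ _)

/-! ### Derivations with bounded length and width. -/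

/-- `Der w n A B`: in `KSdli`, `B` is derivable from `A` in at most `n` steps, through structures of
size at most `w`. -/
inductive Der (w : ℕ) : ℕ → Formula → Formula → Prop
  | refl {n : ℕ} {A B : Formula} (h : Congr A B) (hw : A.size ≤ w) : Der w n A B
  | step {n : ℕ} {A B C : Formula} (h : Der w n A B) (hBC : Step B C) (hw : C.size ≤ w) :
      Der w (n + 1) A C

namespace Der

variable {w n w' n' : ℕ} {A B C : Formula}

theorem mono (h : Der w n A B) (hw : w ≤ w') (hn : n ≤ n') : Der w' n' A B := by
  induction h generalizing n' with
  | refl h hA => exact refl h (hA.trans hw)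
  | step _ hBC hC ih =>
    obtain ⟨k, rfl⟩ : ∃ k, n' = k + 1 := ⟨n' - 1, by omega⟩
    exact step (ih (by omega)) hBC (hC.trans hw)

theorem trans (h : Der w n A B) (h' : Der w n' B C) : Der w (n + n') A C := by
  induction h' with
  | @refl n' B C hBC _ =>
    -- Congruence costs no step: it is absorbed into the last formula of the first derivation.
    refine mono (w := w) (n := n) ?_ le_rfl (by omega)
    cases h with
    | refl hAB hA => exact refl (hAB.trans hBC) hA
    | step h hs hB => exact step h (hs.congr (Congr.refl _) hBC) (hBC.size_eq ▸ hB)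
  | step _ hs hC ih => exact step (ih h) hs hC

theorem or_right (h : Der w n A B) (X : Formula) :
    Der (w + X.size) n (or X A) (or X B) := by
  induction h with
  | refl h hA => exact refl (Congr.or_congr (Congr.refl X) h) (by simp only [size]; omega)
  | step _ hs hC ih => exact step ih (hs.or_right X) (by simp only [size]; omega)

theorem and_right (h : Der w n A B) (X : Formula) :
    Der (w + X.size) n (and X A) (and X B) := by
  induction h with
  | refl h hA => exact refl (Congr.and_congr (Congr.refl X) h) (by simp only [size]; omega)
  | step _ hs hC ih => exact step ih (hs.and_right X) (by simp only [size]; omega)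

theorem congr {A' B' : Formula} (h : Der w n A B) (hA : Congr A' A) (hB : Congr B B') :
    Der w n A' B' := by
  have hw : A.size ≤ w ∧ B.size ≤ w := by
    clear hA hB
    induction h with
    | refl h hA => exact ⟨hA, h.size_eq ▸ hA⟩
    | step _ _ hC ih => exact ⟨ih.1, hC⟩
  have := ((refl (n := 0) hA (hA.size_eq ▸ hw.1)).trans h).trans (refl (n := 0) hB hw.2)
  simpa using this

theorem in_ors (h : Der w n A B) (Γ : List Formula) :
    Der (w + (Γ.map size).sum) n (ors Γ A) (ors Γ B) := by
  induction Γ with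
  | nil => simpa using h
  | cons L Γ ih => exact (ih.or_right L).mono (by simp; omega) le_rfl

theorem single (h : Step A B) (hA : A.size ≤ w) (hB : B.size ≤ w) : Der w 1 A B :=
  step (refl (n := 0) (Congr.refl A) hA) h hB

/-- Disjuncts that occur in `C` are absorbed by `C`. -/
theorem absorb {Γ : List Formula} (h : ∀ x ∈ Γ, Disjunct x C) :
    Der ((Γ.map size).sum + C.size) Γ.length (ors Γ C) C := by
  induction Γ with
  | nil => exact refl (Congr.refl _) (by simp)
  | cons L Γ ih =>
    refine step (((ih fun x hx => h x (List.mem_cons_of_mem _ hx)).or_right L).mono ?_ le_rfl)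
      (Step.absorb (h L List.mem_cons_self)) ?_
    · simp; omega
    · simp

/-- The trailing `ff` is a slot in which any target can be created by weakening; the disjuncts in
front can then be contracted into it. -/
theorem ors_ff (Γ : List Formula) (C : Formula) :
    Der ((Γ.map size).sum + C.size) 1 (ors Γ ff) (ors Γ C) := by
  refine mono ((single (w := C.size) (Step.weakening C) ?_ le_rfl).in_ors Γ) (by omega) le_rfl
  exact C.size_pos

/-- A disjunction entails every formula that contains all its disjuncts. -/
theorem weaken {Γ : List Formula} (h : ∀ x ∈ Γ, Disjunct x C) :
    Der ((Γ.map size).sum + C.size) ((Γ.map size).sum + 1) (ors Γ ff) C :=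
  ((ors_ff Γ C).trans (absorb h)).mono le_rfl (by have := length_le_sum_size Γ; omega)

/-- No rule deletes a unit, so `ff` is weakened to a second copy of `A`, which is contracted. -/
theorem remove_ff (A : Formula) : Der (A.size + A.size) 2 (or A ff) A := by
  have := A.size_pos
  refine step (single (B := or A A) ((Step.weakening A).or_right A) ?_ ?_) (Step.contraction A) ?_
  · simp only [size]; omega
  · exact le_rfl
  · omega

theorem exists_derivation (h : Der w n A B) :
    ∃ Δ : Derivation KSdli (Structure.mk A) (Structure.mk B), Δ.size ≤ (n + 1) * w := by
  induction h with
  | @refl n A B h hA =>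
    rw [← Structure.mk_eq h]
    exact ⟨Derivation.nil, hA.trans (Nat.le_mul_of_pos_left w n.succ_pos)⟩
  | @step n A B C _ hs hC ih =>
    obtain ⟨Δ, hΔ⟩ := ih
    obtain ⟨ρ, hρ, h⟩ := hs
    refine ⟨Derivation.step Δ ρ hρ h, ?_⟩
    change Δ.size + C.size ≤ _
    rw [add_mul _ 1, one_mul]
    exact Nat.add_le_add hΔ hC

end Der

/-! ### Connected lists, chains and iterated switches. -/

/-- A list of lazy formulae each of which interacts with the disjunction of what follows it. -/
def Chain (R : Formula) : List Formula → Prop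
  | [] => True
  | L :: Γ => IsLazy L ∧ CanInteract (ors Γ R) L ∧ Chain R Γ

theorem Chain.der_switch {R : Formula} (hR : IsDeep R) (T : Formula) {Γ : List Formula}
    (h : Chain R Γ) :
    Der ((Γ.map size).sum + R.size + T.size) Γ.length (and (ors Γ R) T) (ors Γ (and R T)) := by
  induction Γ with
  | nil => exact .refl (Congr.refl _) (by simp [size])
  | cons L Γ ih =>
    obtain ⟨hL, hi, hΓ⟩ := h
    -- What remains after the head is either `R` or a proper disjunction, hence deep.
    have hd : IsDeep (ors Γ R) := by
      cases Γ with
      | nil => exact hR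
      | cons => trivial
    have h1 := Der.single (w := (List.map size (L :: Γ)).sum + R.size + T.size)
      (Step.switch (T := T) hi hL hd)
      (by simp [size, size_ors]; omega) (by simp [size, size_ors]; omega)
    exact (h1.trans (((ih hΓ).or_right L).mono (by simp; omega) le_rfl)).mono le_rfl
      (by simp; omega)

/-- No proper nonempty part of the list is closed under interaction. -/
def Connected (Γ : List Formula) : Prop :=
  ∀ T : Set Formula, (∃ x ∈ Γ, x ∈ T) →
    (∀ x ∈ Γ, x ∈ T → ∀ y ∈ Γ, CanInteract x y → y ∈ T) → ∀ x ∈ Γ, x ∈ T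

open Classical in
-- As when growing a spanning tree, some unplaced formula interacts with a placed one or with one
-- outside `X`, whose atoms lie in `R`. The chain grows from its end, next to `R`, towards its head.
theorem Connected.exists_chain {Γ : List Formula} (hΓ : Connected Γ) (hl : ∀ x ∈ Γ, IsLazy x)
    {X : Set Formula} (hX : ∃ x ∈ Γ, x ∉ X) {R : Formula}
    (hR : ∀ x ∈ Γ, x ∉ X → x.atoms ⊆ R.atoms) :
    ∃ Γ', Γ'.Perm (Γ.filter (· ∈ X)) ∧ Chain R Γ' := by
  suffices h : ∀ k ≤ (Γ.filter (· ∈ X)).length, ∃ Γ₁ Γ₂ : List Formula,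
      (Γ₁ ++ Γ₂).Perm (Γ.filter (· ∈ X)) ∧ Γ₁.length = k ∧ Chain R Γ₁ by
    obtain ⟨Γ₁, Γ₂, hp, hk, hc⟩ := h _ le_rfl
    have hlen := hp.length_eq
    rw [List.length_append, hk] at hlen
    obtain rfl : Γ₂ = [] := List.length_eq_zero_iff.1 (by omega)
    exact ⟨Γ₁, by simpa using hp, hc⟩
  obtain ⟨a, ha, haX⟩ := hX
  intro k
  induction k with
  | zero => exact fun _ => ⟨[], _, List.Perm.refl _, rfl, trivial⟩
  | succ k ih =>
    intro hk
    obtain ⟨Γ₁, Γ₂, hp, hk₁, hc⟩ := ih (by omega)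
    have hmem : ∀ z, z ∈ Γ₁ ∨ z ∈ Γ₂ ↔ z ∈ Γ ∧ z ∈ X := fun z => by
      simpa using hp.mem_iff (a := z)
    obtain ⟨y₀, hy₀⟩ : ∃ y, y ∈ Γ₂ := by
      refine List.exists_mem_of_length_pos ?_
      have hlen := hp.length_eq
      rw [List.length_append] at hlen
      omega
    -- Otherwise the complement of the unplaced part `Γ₂` would be closed under interaction; it
    -- contains `a`, so it would contain all of `Γ`.
    obtain ⟨x, hx, hx₂, y, hy, hxy⟩ : ∃ x ∈ Γ, x ∉ Γ₂ ∧ ∃ y ∈ Γ₂, CanInteract x y := by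
      by_contra! hcon
      exact hΓ {z | z ∉ Γ₂} ⟨a, ha, fun h => haX ((hmem a).1 (Or.inr h)).2⟩
        (fun x hx hxT y _ hxy hy => hcon x hx hxT y hy hxy) y₀ ((hmem y₀).1 (Or.inr hy₀)).1 hy₀
    refine ⟨y :: Γ₁, Γ₂.erase y, ?_, by simp [hk₁], hl y ((hmem y).1 (Or.inr hy)).1, ?_, hc⟩
    · exact (List.perm_middle.symm.trans ((List.perm_cons_erase hy).symm.append_left Γ₁)).trans hp
    · refine hxy.mono ?_ subset_rfl
      by_cases hxX : x ∈ X
      · exact atoms_subset_ors_of_mem (((hmem x).2 ⟨hx, hxX⟩).resolve_right hx₂) R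
      · exact (hR x hx hxX).trans (atoms_subset_ors Γ₁ R)

/-- Replacing the part of a connected list outside `X` by a formula with more atoms. -/
theorem Connected.replace {Γ Δ : List Formula} (hΓ : Connected Γ) {X : Set Formula} {C : Formula}
    (hX : ∃ x ∈ Γ, x ∉ X) (hC : ∀ x ∈ Γ, x ∉ X → x.atoms ⊆ C.atoms)
    (hCΔ : C ∈ Δ) (hΔ : ∀ x ∈ Γ, x ∈ X → x ∈ Δ) {T : Set Formula}
    (hT : ∀ x ∈ Δ, x ∈ T → ∀ y ∈ Δ, CanInteract x y → y ∈ T) :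
    (C ∈ T → ∀ x ∈ Γ, x ∈ X → x ∈ T) ∧ (∀ x ∈ Γ, x ∈ X → x ∈ T → C ∈ T) := by
  obtain ⟨a, ha, haX⟩ := hX
  constructor
  -- The formulae outside `X` count as members of the test set, with `C` acting on their behalf.
  · intro hCT x hx
    refine hΓ {z | z ∈ X → z ∈ T} ⟨a, ha, fun h => absurd h haX⟩ ?_ x hx
    intro x hx hxT y hy hxy hyX
    by_cases hxX : x ∈ X
    · exact hT x (hΔ x hx hxX) (hxT hxX) y (hΔ y hy hyX) hxy
    · exact hT C hCΔ hCT y (hΔ y hy hyX) (hxy.mono (hC x hx hxX) subset_rfl)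
  · intro x hx hxX hxT
    -- If `C` were not in `T`, the part of `T` inside `X` could not leave `X`, although
    -- connectedness forces it to reach `a`.
    by_contra hCT
    refine haX (hΓ {z | z ∈ X ∧ z ∈ T} ⟨x, hx, hxX, hxT⟩ ?_ a ha).1
    rintro x hx ⟨hxX, hxT⟩ y hy hxy
    by_cases hyX : y ∈ X
    · exact ⟨hyX, hT x (hΔ x hx hxX) hxT y (hΔ y hy hyX) hxy⟩
    · exact absurd (hT x (hΔ x hx hxX) hxT C hCΔ (hxy.mono subset_rfl (hC y hy hyX))) hCT

/-! ### The invariant of the simulation. -/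

/-- Some connected list of formulae of `X` without repetitions, with a disjunction of size at most
`m`, has a proof in `KSdli` of at most `n` steps through structures of size at most `w`. -/
def Good (m : ℕ) (X : Set Formula) (w n : ℕ) : Prop :=
  ∃ Γ : List Formula, Γ.Nodup ∧ Connected Γ ∧ (∀ x ∈ Γ, x ∈ X) ∧ (Γ.map size).sum + 1 ≤ m ∧
    Der w n tt (ors Γ ff)

theorem Good.mono {m w n w' n' : ℕ} {X X' : Set Formula} (h : Good m X w n) (hX : X ⊆ X')
    (hw : w ≤ w') (hn : n ≤ n') : Good m X' w' n' := by
  obtain ⟨Γ, h1, h2, h3, h4, h5⟩ := h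
  exact ⟨Γ, h1, h2, fun x hx => hX (h3 x hx), h4, h5.mono hw hn⟩

/-- The disjuncts of the formulae of a sequent. -/
def flatSet (φ : Multiset Formula) : Set Formula := {x | ∃ A ∈ φ, x ∈ A.flat}

theorem flatSet_cons (A : Formula) (φ : Multiset Formula) :
    flatSet (A ::ₘ φ) = {x | x ∈ A.flat} ∪ flatSet φ := by
  ext x
  simp [flatSet]

theorem flatSet_add (φ ψ : Multiset Formula) : flatSet (φ + ψ) = flatSet φ ∪ flatSet ψ := by
  ext x
  simp [flatSet, or_and_right, exists_or]

theorem isLazy_of_mem_flatSet {φ : Multiset Formula} {x : Formula} (h : x ∈ flatSet φ) :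
    IsLazy x := by
  obtain ⟨A, _, hx⟩ := h
  exact isLazy_of_mem_flat hx

/-- Without repetitions, the list is a submultiset of all disjuncts of `φ`. This keeps the
selections from growing along the proof. -/
theorem sum_size_le_sequentSize {Γ : List Formula} {φ : Multiset Formula} (hΓ : Γ.Nodup)
    (h : ∀ x ∈ Γ, x ∈ flatSet φ) : (Γ.map size).sum ≤ sequentSize φ := by
  have hle : (Γ : Multiset Formula) ≤ φ.bind fun A => (A.flat : Multiset Formula) := by
    refine (Multiset.le_iff_subset (Multiset.coe_nodup.2 hΓ)).2 fun x hx => ?_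
    obtain ⟨A, hA, hxA⟩ := h x hx
    exact Multiset.mem_bind.2 ⟨A, hA, hxA⟩
  obtain ⟨Δ, hΔ⟩ := Multiset.le_iff_exists_add.1 hle
  have hsum := congrArg (fun s => (Multiset.map size s).sum) hΔ
  simp only [Multiset.map_add, Multiset.sum_add, Multiset.map_bind, Multiset.sum_bind,
    Multiset.map_coe, Multiset.sum_coe] at hsum
  have := Multiset.sum_map_le_sum_map (s := φ) _ _ fun A _ => sum_size_flat_le A
  rw [sequentSize]
  omega

open Classical in
/-- The disjuncts outside `φ` of a provable disjunction are merged into the formula `A` which they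
come from. -/
theorem Good.exists_chain {m w n : ℕ} {A : Formula} {φ : Multiset Formula}
    (h : Good m (flatSet (A ::ₘ φ)) w n) (hA : A.size + 1 ≤ m) :
    Good m (flatSet φ) w n ∨ ∃ Γ Γ' : List Formula, Connected Γ ∧
      (∃ x ∈ Γ, x ∉ flatSet φ) ∧ (∀ x ∈ Γ, x ∉ flatSet φ → x.atoms ⊆ A.atoms) ∧
      (∀ x, x ∈ Γ' ↔ x ∈ Γ ∧ x ∈ flatSet φ) ∧ Chain (or A ff) Γ' ∧ (Γ'.map size).sum + 1 ≤ m ∧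
      Der (w + 2 * m) (n + m + 1) tt (ors Γ' (or A ff)) := by
  obtain ⟨Γ, hnd, hc, hsub, hm, hd⟩ := h
  by_cases hX : ∃ x ∈ Γ, x ∉ flatSet φ
  swap
  · push Not at hX
    exact Or.inl ⟨Γ, hnd, hc, hX, hm, hd⟩
  right
  have hflat : ∀ x ∈ Γ, x ∉ flatSet φ → x ∈ A.flat := fun x hx hxφ =>
    (show x ∈ {x | x ∈ A.flat} ∪ flatSet φ from flatSet_cons A φ ▸ hsub x hx).resolve_right hxφ
  have hat : ∀ x ∈ Γ, x ∉ flatSet φ → x.atoms ⊆ A.atoms := fun x hx hxφ =>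
    atoms_subset_of_mem_flat (hflat x hx hxφ)
  -- The formula `or A ff` is deep even when `A` is a conjunction or `tt`.
  obtain ⟨Γ', hp, hch⟩ := hc.exists_chain (fun x hx => isLazy_of_mem_flatSet (hsub x hx)) hX
    (R := or A ff) fun x hx hxφ => (hat x hx hxφ).trans Set.subset_union_left
  set α := Γ.filter fun x => !decide (x ∈ flatSet φ) with hα
  have hperm : Γ.Perm (Γ' ++ α) :=
    (List.filter_append_perm _ Γ).symm.trans (hp.symm.append_right α)
  have hsum : (Γ.map size).sum = (Γ'.map size).sum + (α.map size).sum := by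
    rw [(hperm.map size).sum_eq, List.map_append, List.sum_append]
  refine ⟨Γ, Γ', hc, hX, hat, fun x => by simp [hp.mem_iff], hch, by omega, ?_⟩
  -- The trailing `ff` becomes `or A ff`, which then absorbs the disjuncts in `α`.
  have h₁ := Der.ors_ff Γ (or A ff)
  have h₂ : Der _ _ (ors α (or A ff)) (or A ff) := Der.absorb fun x hx => by
    simp only [hα, List.mem_filter, Bool.not_eq_true', decide_eq_false_iff_not] at hx
    exact (disjunct_of_mem_flat (hflat x hx.1 hx.2)).or_left ff
  have h₃ := (h₂.in_ors Γ').congr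
    (ors_append Γ' α _ ▸ ors_perm hperm _) (Congr.refl _)
  have hlen := length_le_sum_size α
  simp only [size] at h₁ h₃
  exact (((hd.mono (w' := w + 2 * m) (by omega) le_rfl).trans
    (h₁.mono (by omega) le_rfl)).trans (h₃.mono (by omega) le_rfl)).mono le_rfl (by omega)

/-! ### The Gentzen rules. -/

/-- Switching out `Γ` and then `Δ` leaves the conjunction of `or A ff` and `or B ff`. The two
auxiliary units are removed, and a fresh `ff` restores the normal form. -/
theorem Der.pull {Γ Δ : List Formula} {A B : Formula} (hΓ : Chain (or A ff) Γ)
    (hΔ : Chain (or B ff) Δ) {m : ℕ} (hA : A.size + 1 ≤ m) (hB : B.size + 1 ≤ m)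
    (hΓm : (Γ.map size).sum + 1 ≤ m) (hΔm : (Δ.map size).sum + 1 ≤ m) :
    Der (6 * m) (2 * m + 5) (and (ors Γ (or A ff)) (ors Δ (or B ff)))
      (ors (Γ ++ Δ ++ [and A B]) ff) := by
  have h₁ := hΓ.der_switch (R := or A ff) trivial (ors Δ (or B ff))
  have h₂ := (((hΔ.der_switch (R := or B ff) trivial (or A ff)).congr (Congr.and_comm _ _)
    (Congr.refl _)).in_ors Γ)
  have h₃ := (((Der.remove_ff A).and_right (or B ff)).in_ors Δ).in_ors Γ
  have h₄ := (((((Der.remove_ff B).and_right A).congr (Congr.and_comm _ _)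
    (Congr.refl _)).in_ors Δ).in_ors Γ)
  have h₅ := (((Der.single (w := A.size + B.size + 1) (Step.or_ff (and A B))
    (by simp [size]) (by simp [size])).in_ors Δ).in_ors Γ)
  have hlΓ := length_le_sum_size Γ
  have hlΔ := length_le_sum_size Δ
  simp only [size, size_ors] at h₁ h₂ h₃ h₄ h₅
  rw [ors_append, ors_append]
  replace h₁ := h₁.mono (w' := 6 * m) (by omega) le_rfl
  replace h₂ := h₂.mono (w' := 6 * m) (by omega) le_rfl
  replace h₃ := h₃.mono (w' := 6 * m) (by omega) le_rfl
  replace h₄ := h₄.mono (w' := 6 * m) (by omega) le_rfl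
  replace h₅ := h₅.mono (w' := 6 * m) (by omega) le_rfl
  exact ((((h₁.trans h₂).trans h₃).trans h₄).trans h₅).mono le_rfl (by omega)

open Classical in
theorem Good.and_rule {m w₁ n₁ w₂ n₂ : ℕ} {A B : Formula} {φ ψ : Multiset Formula}
    (h₁ : Good m (flatSet (A ::ₘ φ)) w₁ n₁) (h₂ : Good m (flatSet (B ::ₘ ψ)) w₂ n₂)
    (hm : sequentSize (and A B ::ₘ (φ + ψ)) + 1 ≤ m) :
    Good m (flatSet (and A B ::ₘ (φ + ψ))) (w₁ + w₂ + 16 * m) (n₁ + n₂ + 16 * m) := by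
  have hAm : A.size + B.size + 1 ≤ m := by
    simp only [sequentSize, Multiset.map_cons, Multiset.sum_cons, size] at hm
    omega
  have hA := A.size_pos
  have hB := B.size_pos
  have hφ : flatSet φ ⊆ flatSet (Formula.and A B ::ₘ (φ + ψ)) := by
    rw [flatSet_cons, flatSet_add]
    exact Set.subset_union_left.trans Set.subset_union_right
  have hψ : flatSet ψ ⊆ flatSet (Formula.and A B ::ₘ (φ + ψ)) := by
    rw [flatSet_cons, flatSet_add]
    exact Set.subset_union_right.trans Set.subset_union_right
  -- If one selection avoids the active formula, it already serves for the conclusion.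
  rcases h₁.exists_chain (by omega) with h₁ | ⟨Γ, Γ', hΓ, hΓX, hΓA, hΓ', hΓc, hΓm, h₁⟩
  · exact h₁.mono hφ (by omega) (by omega)
  rcases h₂.exists_chain (by omega) with h₂ | ⟨Δ, Δ', hΔ, hΔX, hΔB, hΔ', hΔc, hΔm, h₂⟩
  · exact h₂.mono hψ (by omega) (by omega)
  set Λ := (Γ' ++ Δ' ++ [Formula.and A B]).dedup with hΛ
  have hmem : ∀ x, x ∈ Λ ↔ x ∈ Γ' ∨ x ∈ Δ' ∨ x = Formula.and A B := fun x => by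
    simp [hΛ]
  have hsub : ∀ x ∈ Λ, x ∈ flatSet (Formula.and A B ::ₘ (φ + ψ)) := by
    intro x hx
    rcases (hmem x).1 hx with hx | hx | rfl
    · exact hφ ((hΓ' x).1 hx).2
    · exact hψ ((hΔ' x).1 hx).2
    · exact ⟨_, Multiset.mem_cons_self _ _, List.mem_singleton_self _⟩
  have hnd : Λ.Nodup := List.nodup_dedup _
  have hΛm := sum_size_le_sequentSize hnd hsub
  refine ⟨Λ, hnd, ?_, hsub, by omega, ?_⟩
  -- The new conjunction is the hub: a closed set meeting either side contains it, and then contains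
  -- both sides.
  · intro T hT hcl
    have hC : Formula.and A B ∈ Λ := (hmem _).2 (Or.inr (Or.inr rfl))
    obtain ⟨hΓ₁, hΓ₂⟩ := hΓ.replace (C := Formula.and A B) hΓX
      (fun x hx hxX => (hΓA x hx hxX).trans Set.subset_union_left) hC
      (fun x hx hxX => (hmem x).2 (Or.inl ((hΓ' x).2 ⟨hx, hxX⟩))) hcl
    obtain ⟨hΔ₁, hΔ₂⟩ := hΔ.replace (C := Formula.and A B) hΔX
      (fun x hx hxX => (hΔB x hx hxX).trans Set.subset_union_right) hC
      (fun x hx hxX => (hmem x).2 (Or.inr (Or.inl ((hΔ' x).2 ⟨hx, hxX⟩)))) hcl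
    have hCT : Formula.and A B ∈ T := by
      obtain ⟨x, hx, hxT⟩ := hT
      rcases (hmem x).1 hx with hx | hx | rfl
      · exact hΓ₂ x ((hΓ' x).1 hx).1 ((hΓ' x).1 hx).2 hxT
      · exact hΔ₂ x ((hΔ' x).1 hx).1 ((hΔ' x).1 hx).2 hxT
      · exact hxT
    intro x hx
    rcases (hmem x).1 hx with hx | hx | rfl
    · exact hΓ₁ hCT x ((hΓ' x).1 hx).1 ((hΓ' x).1 hx).2
    · exact hΔ₁ hCT x ((hΔ' x).1 hx).1 ((hΔ' x).1 hx).2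
    · exact hCT
  · have d₁ : Der 2 1 tt (Formula.and tt tt) :=
      Der.single (Step.and_tt tt) (by simp [size]) (by simp [size])
    have d₂ := (h₁.and_right tt).congr (Congr.refl _) (Congr.and_comm _ _)
    have d₃ := h₂.and_right (ors Γ' (Formula.or A ff))
    have d₄ := Der.pull hΓc hΔc (m := m) (by omega) (by omega) hΓm hΔm
    -- Contractions remove the duplicates shared by the two sides.
    have d₅ := Der.weaken (Γ := Γ' ++ Δ' ++ [Formula.and A B]) (C := ors Λ ff) fun x hx =>
      disjunct_ors (List.mem_dedup.2 hx) ff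
    simp only [size, size_ors, List.map_append, List.sum_append, List.map_cons, List.map_nil,
      List.sum_cons, List.sum_nil] at d₂ d₃ d₅
    replace d₁ := d₁.mono (w' := w₁ + w₂ + 16 * m) (by omega) le_rfl
    replace d₂ := d₂.mono (w' := w₁ + w₂ + 16 * m) (by omega) le_rfl
    replace d₃ := d₃.mono (w' := w₁ + w₂ + 16 * m) (by omega) le_rfl
    replace d₄ := d₄.mono (w' := w₁ + w₂ + 16 * m) (by omega) le_rfl
    replace d₅ := d₅.mono (w' := w₁ + w₂ + 16 * m) (by omega) le_rfl
    exact ((((d₁.trans d₂).trans d₃).trans d₄).trans d₅).mono le_rfl (by omega)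

theorem Good.tt_intro {m : ℕ} (hm : 2 ≤ m) : Good m (flatSet {Formula.tt}) (16 * m) (16 * m) := by
  refine ⟨[Formula.tt], List.nodup_singleton _, ?_, ?_, by simpa [size] using hm, ?_⟩
  · rintro T ⟨x, hx, hxT⟩ _ y hy
    rwa [List.mem_singleton.1 hy, ← List.mem_singleton.1 hx]
  · exact fun x hx => ⟨Formula.tt, Multiset.mem_singleton_self _, hx⟩
  · exact (Der.single (w := 2) (Step.or_ff _) (by simp [size]) (by simp [size])).mono
      (by omega) (by omega)

theorem Good.atom_intro {m : ℕ} (hm : 3 ≤ m) (n : ℕ) :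
    Good m (flatSet {Formula.atom n, Formula.natom n}) (16 * m) (16 * m) := by
  have hi : CanInteract (Formula.atom n) (Formula.natom n) := ⟨Formula.natom n, rfl, rfl⟩
  refine ⟨[Formula.atom n, Formula.natom n], by simp, ?_, ?_, by simpa [size] using hm, ?_⟩
  · rintro T ⟨x, hx, hxT⟩ hcl
    have h₁ := hcl (Formula.atom n) (by simp)
    have h₂ := hcl (Formula.natom n) (by simp)
    simp only [List.mem_cons, List.not_mem_nil, or_false, forall_eq_or_imp, forall_eq] at hx h₁ h₂ ⊢
    rcases hx with rfl | rfl
    · exact ⟨hxT, (h₁ hxT).2 hi⟩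
    · exact ⟨(h₂ hxT).1 hi.symm, hxT⟩
  · simp [flatSet, flat]
  · have d₁ : Der 3 1 Formula.tt _ :=
      Der.single (Step.interaction n) (by simp [size]) (by simp [size])
    have d₂ := d₁.step (Step.or_ff _) (by simp [size])
    exact (d₂.congr (Congr.refl _) (Congr.or_assoc _ _ _)).mono (by omega) (by omega)

/-- The axiom is expanded to atoms and units, and `k` counts the nodes of the formula tree of `A`:
with `A.size` leaves there are `2 * A.size - 1` of them, each costing `16 * m`. -/
theorem Good.identity {m : ℕ} (A : Formula) (hm : 2 * A.size + 1 ≤ m) :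
    ∃ k, k + 1 ≤ 2 * A.size ∧ Good m (flatSet {A, A.neg}) (16 * m * k) (16 * m * k) := by
  -- By duality, conjunctions and disjunctions share this step; only sizes of the primed formulae
  -- matter, not that they are negations.
  have key : ∀ {A B A' B' : Formula} {k l : ℕ}, A'.size = A.size → B'.size = B.size →
      2 * (A.size + B.size) + 1 ≤ m → k + 1 ≤ 2 * A.size → l + 1 ≤ 2 * B.size →
      Good m (flatSet {A, A'}) (16 * m * k) (16 * m * k) →
      Good m (flatSet {B, B'}) (16 * m * l) (16 * m * l) →
      ∃ j, j + 1 ≤ 2 * (A.size + B.size) ∧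
        Good m (flatSet {Formula.and A B, Formula.or A' B'}) (16 * m * j) (16 * m * j) := by
    intro A B A' B' k l hA hB hm hk hl h₁ h₂
    refine ⟨k + l + 1, by omega, (h₁.and_rule (φ := {A'}) h₂ (ψ := {B'}) ?_).mono ?_ ?_ ?_⟩
    · simp [sequentSize, size]
      omega
    · intro x
      simp [flatSet, flat]
    · exact le_of_eq (by ring)
    · exact le_of_eq (by ring)
  induction A with
  -- `ff` has no disjuncts, so for either unit the selection is `tt` alone.
  | ff => exact ⟨1, by simp [size], (Good.tt_intro (by simp only [size] at hm; omega)).mono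
      (by intro x; simp +contextual [flatSet, neg]) (by simp) (by simp)⟩
  | tt => exact ⟨1, by simp [size], (Good.tt_intro (by simp only [size] at hm; omega)).mono
      (by intro x; simp +contextual [flatSet]) (by simp) (by simp)⟩
  | atom n => exact ⟨1, by simp [size], (Good.atom_intro (by simp only [size] at hm; omega) n).mono
      subset_rfl (by simp) (by simp)⟩
  | natom n =>
    refine ⟨1, by simp [size], (Good.atom_intro (by simp only [size] at hm; omega) n).mono
      ?_ (by simp) (by simp)⟩
    rw [Multiset.pair_comm]
    exact subset_rfl
  | and A B ihA ihB =>
    simp only [size] at hm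
    obtain ⟨k, hk, h₁⟩ := ihA (by omega)
    obtain ⟨l, hl, h₂⟩ := ihB (by omega)
    exact key A.size_neg B.size_neg hm hk hl h₁ h₂
  | or A B ihA ihB =>
    simp only [size] at hm
    obtain ⟨k, hk, h₁⟩ := ihA (by omega)
    obtain ⟨l, hl, h₂⟩ := ihB (by omega)
    rw [Multiset.pair_comm] at h₁ h₂
    obtain ⟨j, hj, h⟩ := key A.size_neg.symm B.size_neg.symm
      (by rwa [size_neg, size_neg]) (by rwa [size_neg]) (by rwa [size_neg]) h₁ h₂
    rw [size_neg, size_neg] at hj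
    rw [Multiset.pair_comm] at h
    exact ⟨j, hj, h⟩

/-! ### The simulation and its size. -/

theorem GentzenProof.sequentSize_le {φ : Multiset Formula} (Φ : GentzenProof φ) :
    sequentSize φ ≤ Φ.size := by
  cases Φ <;> simp [GentzenProof.size]

/-- A single `m` bounds every selection in the whole tree, so the costs add up along it. Weakening,
contraction and disjunction at most enlarge the set of available disjuncts and reuse the derivation.
-/
theorem GentzenProof.good {φ : Multiset Formula} (Φ : GentzenProof φ) {m : ℕ}
    (hm : Φ.size + 1 ≤ m) : Good m (flatSet φ) (16 * m * Φ.size) (16 * m * Φ.size) := by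
  induction Φ with
  | id A =>
    have hs : (GentzenProof.id A).size = 2 * A.size := by
      simp [GentzenProof.size, sequentSize, size_neg, two_mul]
    rw [hs] at hm ⊢
    obtain ⟨k, hk, h⟩ := Good.identity A hm
    have := Nat.mul_le_mul_left (16 * m) (show k ≤ 2 * A.size by omega)
    exact h.mono subset_rfl this this
  | tt =>
    have hs : GentzenProof.tt.size = 1 := by simp [GentzenProof.size, sequentSize, Formula.size]
    rw [hs, mul_one] at *
    exact Good.tt_intro hm
  | @weak φ A Φ ih =>
    simp only [GentzenProof.size] at hm ⊢
    have := Nat.mul_le_mul_left (16 * m) (Nat.le_add_right Φ.size (sequentSize (A ::ₘ φ)))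
    refine (ih (by omega)).mono ?_ this this
    rw [flatSet_cons]
    exact Set.subset_union_right
  | @contr φ A Φ ih =>
    simp only [GentzenProof.size] at hm ⊢
    have := Nat.mul_le_mul_left (16 * m) (Nat.le_add_right Φ.size (sequentSize (A ::ₘ φ)))
    refine (ih (by omega)).mono ?_ this this
    rw [flatSet_cons, flatSet_cons, ← Set.union_assoc, Set.union_self]
  | @or φ A B Φ ih =>
    simp only [GentzenProof.size] at hm ⊢
    have := Nat.mul_le_mul_left (16 * m)
      (Nat.le_add_right Φ.size (sequentSize (Formula.or A B ::ₘ φ)))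
    refine (ih (by omega)).mono ?_ this this
    intro x
    simp [flatSet_cons, flat, or_assoc]
  | @and φ ψ A B Φ Ψ ih₁ ih₂ =>
    simp only [GentzenProof.size] at hm ⊢
    have hpos : 1 ≤ sequentSize (Formula.and A B ::ₘ (φ + ψ)) := by
      have := A.size_pos
      simp only [sequentSize, Multiset.map_cons, Multiset.sum_cons, Formula.size]
      omega
    have hle := Nat.mul_le_mul_left (16 * m) (Nat.add_le_add_left hpos (Φ.size + Ψ.size))
    have hle' : 16 * m * Φ.size + 16 * m * Ψ.size + 16 * m ≤
        16 * m * (Φ.size + Ψ.size + sequentSize (Formula.and A B ::ₘ (φ + ψ))) :=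
      le_trans (le_of_eq (by ring)) hle
    exact ((ih₁ (by omega)).and_rule (ih₂ (by omega)) (by omega)).mono subset_rfl hle' hle'

theorem GentzenProof.exists_derivation {φ : Multiset Formula} (Φ : GentzenProof φ) :
    ∃ Δ : Derivation KSdli (Structure.mk Formula.tt) (sequentStructure φ),
      Δ.size ≤ 324 * (Φ.size + 1) ^ 4 := by
  induction φ using Quotient.inductionOn with
  | h L =>
    obtain ⟨Γ, hnd, _, hsub, hm, hd⟩ := Φ.good le_rfl
    have hC : ∀ x ∈ Γ, Disjunct x (listOr L) := fun x hx => by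
      obtain ⟨A, hA, hxA⟩ := hsub x hx
      exact disjunct_of_mem_flat (mem_flat_listOr hA hxA)
    -- The extra one covers the empty disjunction, which denotes `ff`.
    have hL : (listOr L).size ≤ Φ.size + 1 := by
      refine (size_listOr_le L).trans (Nat.add_le_add_right ?_ 1)
      simpa [sequentSize] using Φ.sequentSize_le
    set m := Φ.size + 1 with hmdef
    have hle : 16 * m * Φ.size ≤ 16 * m * m := Nat.mul_le_mul_left _ (by omega)
    have hm2 : m ≤ m * m := Nat.le_mul_of_pos_left m (by omega)
    have h := (hd.mono (w' := 18 * (m * m)) (n' := 16 * (m * m))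
      (by linarith) (by linarith)).trans ((Der.weaken hC).mono (by omega) le_rfl)
    obtain ⟨Δ, hΔ⟩ := (h.mono le_rfl
      (show _ ≤ 17 * (m * m) by omega)).exists_derivation
    refine ⟨Δ, hΔ.trans ?_⟩
    -- Number of structures times width; `324` is `18 * 18`.
    calc (17 * (m * m) + 1) * (18 * (m * m)) ≤ (18 * (m * m)) * (18 * (m * m)) :=
          Nat.mul_le_mul_right _ (by omega)
      _ = 324 * m ^ 4 := by ring

end DeepInf

theorem mainTheorem10 :
    DeepInf.PolynomiallySimulates
      (DeepInf.deepProofSystem DeepInf.KSdli) DeepInf.analyticGentzen := by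
  refine ⟨324 * (Polynomial.X + 1) ^ 4, fun Φ => ?_⟩
  obtain ⟨Δ, hΔ⟩ := Φ.2.exists_derivation
  refine ⟨⟨_, Δ⟩, rfl, ?_⟩
  refine hΔ.trans (le_of_eq ?_)
  simp [DeepInf.analyticGentzen]
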